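/- Call a finite set $\Delta$ of existential rules $\forall \mathbf{x}\,(\varphi(\mathbf{x}) \to \exists \mathbf{y}\,\psi(\mathbf{x}',\mathbf{y}))$, with $\varphi,\psi$ nonempty conjunctions of relational atoms (of arbitrary positive arity) and $\mathbf{x}'\subseteq\mathbf{x}$, *source-to-target* if there are disjoint sets $\sigma_S$ and $\sigma_T$ of relation symbols such that all bodies of rules in $\Delta$ use only symbols of $\sigma_S$ and all heads use only symbols of $\sigma_T$. For a class $\mathcal{L}$ of logical constraints on unary and binary relations, the query answering problem for source-to-target rules combined with $\mathcal{L}$ is: given a fact $F$ (a finite conjunction of atoms, whose variables are read existentially), a finite source-to-target set $\Delta$ of existential rules, a finite set $\Sigma$ of constraints of $\mathcal{L}$, and a Boolean conjunctive query $q$, decide whether $F \wedge \Delta \wedge \Sigma \models q$, that is, whether every (finite or infinite, nonempty) interpretation that satisfies $\Delta$, $\Sigma$ and the existential closure of $F$ also satisfies $q$. **Theorem.** Source-to-target existential rules are destructive when combined with description logics: the query answering problem for source-to-target rules combined with $\mathcal{L}$ is undecidable 1. when $\mathcal{L}$ is the description logic $\mathcal{ALCF}$, whose constraints are the concept inclusions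 $C \sqsubseteq C'$ between $\mathcal{ALC}$ concepts (built from $\top$, $\bot$ and concept names by $\neg$, $\sqcap$, $\sqcup$, $\exists R\,C$ and $\forall R\,C$) and the functionality assertions $\mathrm{Funct}(R)$ on role names $R$; and 2. when $\mathcal{L}$ is $\mathrm{GC}^2$, the two-variable guarded fragment of first-order logic with counting quantifiers, whose constraints are its sentences. -/

import Mathlib

/-! ### Relational signatures, atoms, interpretations

Relation symbols are pairs `(name, arity)`; variables are natural numbers.  Every input mentions
only finitely many symbols, and relations of every arity are available. -/

/-- An atom `R(x₁, …, xₙ)`: the name of `R` and the list of its argument variables.  Its relation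
symbol is `(name, n)`, where `n` is the number of arguments. -/
abbrev Atom := ℕ × List ℕ

namespace Atom

/-- The list of argument variables of an atom. -/
abbrev args (a : Atom) : List ℕ := a.2

/-- The relation symbol `(name, arity)` of an atom. -/
def symbol (a : Atom) : ℕ × ℕ := (a.1, a.2.length)

end Atom

/-- A (possibly infinite) interpretation with domain `D`: each relation symbol `(R, n)` is
interpreted by a set of `n`-tuples. -/
structure Interp (D : Type) where
  rel : (R : ℕ) → (n : ℕ) → Set (Fin n → D)

namespace Interp

variable {D : Type}

/-- The interpretation of a unary relation symbol. -/
def unary (I : Interp D) (A : ℕ) (d : D) : Prop := ![d] ∈ I.rel A 1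

/-- The interpretation of a binary relation symbol. -/
def binary (I : Interp D) (R : ℕ) (d e : D) : Prop := ![d, e] ∈ I.rel R 2

/-- The atom `a` holds in `I` under the assignment `v`. -/
def holdsAtom (I : Interp D) (v : ℕ → D) (a : Atom) : Prop :=
  (fun i : Fin a.args.length => v (a.args.get i)) ∈ I.rel a.1 a.args.length

/-- All the atoms of the conjunction `Φ` hold in `I` under the assignment `v`. -/
def holdsConj (I : Interp D) (v : ℕ → D) (Φ : List Atom) : Prop :=
  ∀ a ∈ Φ, I.holdsAtom v a

/-- `I` satisfies the existential closure of the conjunction `Φ`: this is the semantics of facts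
(whose variables are existentially closed) and of Boolean conjunctive queries. -/
def satEx (I : Interp D) (Φ : List Atom) : Prop := ∃ v : ℕ → D, I.holdsConj v Φ

end Interp

/-- A genuine conjunction of atoms: at least one atom, and all atoms of positive arity. -/
def IsAtomConj (Φ : List Atom) : Prop := Φ ≠ [] ∧ ∀ a ∈ Φ, a.args ≠ []

/-! ### Existential rules -/

/-- An existential rule `∀ x (φ(x) → ∃ y ψ(x', y))`, given by its body `φ` and its head `ψ`; the
universally quantified variables are those of the body, and the existentially quantified ones are
the variables of the head that do not occur in the body. -/
abbrev ExRule := List Atom × List Atom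

namespace ExRule

abbrev body (ρ : ExRule) : List Atom := ρ.1

abbrev head (ρ : ExRule) : List Atom := ρ.2

/-- `I` satisfies the rule: each match of the body extends to a match of the head. -/
def Sat {D : Type} (I : Interp D) (ρ : ExRule) : Prop :=
  ∀ v : ℕ → D, I.holdsConj v ρ.body →
    ∃ w : ℕ → D, (∀ a ∈ ρ.body, ∀ x ∈ a.args, w x = v x) ∧ I.holdsConj w ρ.head

end ExRule

/-- The finite set `Δ` of existential rules is source-to-target: for some disjoint sets of source
and target relation symbols, all bodies use only source symbols and all heads use only target
symbols. -/
def IsSourceToTarget (Δ : List ExRule) : Prop :=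
  ∃ source target : Set (ℕ × ℕ), Disjoint source target ∧
    ∀ ρ ∈ Δ, IsAtomConj ρ.body ∧ IsAtomConj ρ.head ∧
      (∀ a ∈ ρ.body, a.symbol ∈ source) ∧ (∀ a ∈ ρ.head, a.symbol ∈ target)

/-! ### The description logic ALCF -/

/-- `ALC` concepts; the concept name `A` is the unary symbol `(A, 1)` and the role name `R` is the
binary symbol `(R, 2)`. -/
inductive ALCConcept where
  | top : ALCConcept
  | bot : ALCConcept
  | name : (A : ℕ) → ALCConcept
  | neg : ALCConcept → ALCConcept
  | inf : ALCConcept → ALCConcept → ALCConcept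
  | sup : ALCConcept → ALCConcept → ALCConcept
  | ex : (R : ℕ) → ALCConcept → ALCConcept
  | all : (R : ℕ) → ALCConcept → ALCConcept

namespace ALCConcept

/-- The extension of a concept in an interpretation. -/
def ext {D : Type} (I : Interp D) : ALCConcept → Set D
  | top => Set.univ
  | bot => ∅
  | name A => {d | I.unary A d}
  | neg C => (ext I C)ᶜ
  | inf C C' => ext I C ∩ ext I C'
  | sup C C' => ext I C ∪ ext I C'
  | ex R C => {d | ∃ e, I.binary R d e ∧ e ∈ ext I C}
  | all R C => {d | ∀ e, I.binary R d e → e ∈ ext I C}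

/-- Gödel numbering of concepts. -/
def toNat : ALCConcept → ℕ
  | top => 0
  | bot => 1
  | name A => 6 * A + 0 + 2
  | neg C => 6 * toNat C + 1 + 2
  | inf C C' => 6 * Nat.pair (toNat C) (toNat C') + 2 + 2
  | sup C C' => 6 * Nat.pair (toNat C) (toNat C') + 3 + 2
  | ex R C => 6 * Nat.pair R (toNat C) + 4 + 2
  | all R C => 6 * Nat.pair R (toNat C) + 5 + 2

/-- The concept with a given Gödel number. -/
def ofNat : ℕ → ALCConcept
  | 0 => top
  | 1 => bot
  | n + 2 =>
    have h0 : n / 6 < n + 2 := by omega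
    have h1 : (n / 6).unpair.1 < n + 2 := lt_of_le_of_lt (Nat.unpair_left_le _) h0
    have h2 : (n / 6).unpair.2 < n + 2 := lt_of_le_of_lt (Nat.unpair_right_le _) h0
    match n % 6 with
    | 0 => name (n / 6)
    | 1 => neg (ofNat (n / 6))
    | 2 => inf (ofNat (n / 6).unpair.1) (ofNat (n / 6).unpair.2)
    | 3 => sup (ofNat (n / 6).unpair.1) (ofNat (n / 6).unpair.2)
    | 4 => ex (n / 6).unpair.1 (ofNat (n / 6).unpair.2)
    | _ => all (n / 6).unpair.1 (ofNat (n / 6).unpair.2)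

theorem ofNat_toNat (C : ALCConcept) : ofNat (toNat C) = C := by
  have hd : ∀ m k : ℕ, k < 6 → (6 * m + k) / 6 = m := by intros; omega
  have hm : ∀ m k : ℕ, k < 6 → (6 * m + k) % 6 = k := by intros; omega
  have hd0 : ∀ m : ℕ, 6 * m / 6 = m := by intros; omega
  have hm0 : ∀ m : ℕ, 6 * m % 6 = 0 := by intros; omega
  induction C <;> simp [toNat, ofNat, hd, hm, hd0, hm0, *]

theorem toNat_ofNat (n : ℕ) : toNat (ofNat n) = n := by
  induction n using Nat.strong_induction_on with
  | _ n ih =>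
    match n with
    | 0 => simp [toNat, ofNat]
    | 1 => simp [toNat, ofNat]
    | n + 2 =>
      have h0 : n / 6 < n + 2 := by omega
      have h1 : (n / 6).unpair.1 < n + 2 := lt_of_le_of_lt (Nat.unpair_left_le _) h0
      have h2 : (n / 6).unpair.2 < n + 2 := lt_of_le_of_lt (Nat.unpair_right_le _) h0
      have hlt : n % 6 < 6 := Nat.mod_lt _ (by norm_num)
      have hdm := Nat.div_add_mod n 6
      simp only [ofNat]
      generalize hk : n % 6 = k at *
      interval_cases k <;> simp only [toNat, ih _ h0, ih _ h1, ih _ h2, Nat.pair_unpair] <;> omega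

/-- Concepts are effectively numbered; this makes computability over concepts meaningful. -/
instance : Denumerable ALCConcept :=
  Denumerable.mk' ⟨toNat, ofNat, ofNat_toNat, toNat_ofNat⟩

end ALCConcept

/-- Assertions of the description logic `ALCF`: `Sum.inl (C, C')` is the concept inclusion
`C ⊑ C'`, and `Sum.inr R` is the functionality assertion `Funct(R)`. -/
abbrev ALCFAssertion := (ALCConcept × ALCConcept) ⊕ ℕ

/-- Satisfaction of an `ALCF` assertion. -/
def ALCFAssertion.Sat {D : Type} (I : Interp D) : ALCFAssertion → Prop
  | Sum.inl (C, C') => C.ext I ⊆ C'.ext I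
  | Sum.inr R => ∀ d e e' : D, I.binary R d e → I.binary R d e' → e = e'

/-! ### The two-variable guarded fragment with counting -/

/-- Two-variable formulas; the two variables are `false` and `true`.
`ex u φ` is `∃ u φ`, and `count n u R w φ` is `∃^{≥ n} u (R(w, w') ∧ φ)`, where `w'` is the
variable other than `w` (so the guard contains both variables).
The quantifiers `∀`, `∃^{≤ n}`, `∃^{= n}` and the other connectives are definable by negation and
conjunction. -/
inductive GC2Formula where
  | eq : (u w : Bool) → GC2Formula
  | un : (A : ℕ) → (u : Bool) → GC2Formula
  | bin : (R : ℕ) → (u w : Bool) → GC2Formula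
  | neg : GC2Formula → GC2Formula
  | and : GC2Formula → GC2Formula → GC2Formula
  | ex : (u : Bool) → GC2Formula → GC2Formula
  | count : (n : ℕ) → (u : Bool) → (R : ℕ) → (w : Bool) → GC2Formula → GC2Formula

namespace GC2Formula

/-- `Free φ z`: the variable `z` is free in `φ`. -/
def Free : GC2Formula → Bool → Prop
  | eq u w, z => z = u ∨ z = w
  | un _ u, z => z = u
  | bin _ u w, z => z = u ∨ z = w
  | neg φ, z => Free φ z
  | and φ ψ, z => Free φ z ∨ Free ψ z
  | ex u φ, z => z ≠ u ∧ Free φ z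
  | count _ u _ _ _, z => z ≠ u

/-- The formula is in `GC²`: unguarded (non-counting) quantification is applied only to formulas
with at most one free variable. -/
def Guarded : GC2Formula → Prop
  | eq _ _ => True
  | un _ _ => True
  | bin _ _ _ => True
  | neg φ => Guarded φ
  | and φ ψ => Guarded φ ∧ Guarded ψ
  | ex _ φ => Guarded φ ∧ ∃ w, ∀ z, Free φ z → z = w
  | count _ _ _ _ φ => Guarded φ

/-- `GC²` sentences. -/
def IsSentence (φ : GC2Formula) : Prop := φ.Guarded ∧ ∀ z, ¬ φ.Free z

/-- Truth of a formula under an assignment of the two variables. -/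
def Eval {D : Type} (I : Interp D) : GC2Formula → (Bool → D) → Prop
  | eq u w, v => v u = v w
  | un A u, v => I.unary A (v u)
  | bin R u w, v => I.binary R (v u) (v w)
  | neg φ, v => ¬ Eval I φ v
  | and φ ψ, v => Eval I φ v ∧ Eval I ψ v
  | ex u φ, v => ∃ d : D, Eval I φ (Function.update v u d)
  | count n u R w φ, v =>
      (n : ℕ∞) ≤ Set.encard {d : D |
        I.binary R (Function.update v u d w) (Function.update v u d (!w)) ∧
          Eval I φ (Function.update v u d)}

/-- Satisfaction of a sentence (its truth does not depend on the assignment). -/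
def Sat {D : Type} (I : Interp D) (φ : GC2Formula) : Prop := ∀ v : Bool → D, φ.Eval I v

/-- Gödel numbering of formulas. -/
def toNat : GC2Formula → ℕ
  | eq false false => 0
  | eq false true => 1
  | eq true false => 2
  | eq true true => 3
  | un A u => 6 * Nat.bit u A + 0 + 4
  | bin R u w => 6 * Nat.bit u (Nat.bit w R) + 1 + 4
  | neg φ => 6 * toNat φ + 2 + 4
  | and φ ψ => 6 * Nat.pair (toNat φ) (toNat ψ) + 3 + 4
  | ex u φ => 6 * Nat.bit u (toNat φ) + 4 + 4
  | count n u R w φ =>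
      6 * Nat.bit u (Nat.bit w (Nat.pair (Nat.pair n R) (toNat φ))) + 5 + 4

/-- The formula with a given Gödel number. -/
def ofNat : ℕ → GC2Formula
  | 0 => eq false false
  | 1 => eq false true
  | 2 => eq true false
  | 3 => eq true true
  | n + 4 =>
    have h0 : n / 6 < n + 4 := by omega
    have h1 : (n / 6).unpair.1 < n + 4 := lt_of_le_of_lt (Nat.unpair_left_le _) h0
    have h2 : (n / 6).unpair.2 < n + 4 := lt_of_le_of_lt (Nat.unpair_right_le _) h0
    have h3 : (n / 6).div2 < n + 4 := by rw [Nat.div2_val]; omega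
    have h4 : (n / 6).div2.div2.unpair.2 < n + 4 :=
      lt_of_le_of_lt (Nat.unpair_right_le _) (by rw [Nat.div2_val, Nat.div2_val]; omega)
    match n % 6 with
    | 0 => un (n / 6).div2 (n / 6).bodd
    | 1 => bin (n / 6).div2.div2 (n / 6).bodd (n / 6).div2.bodd
    | 2 => neg (ofNat (n / 6))
    | 3 => and (ofNat (n / 6).unpair.1) (ofNat (n / 6).unpair.2)
    | 4 => ex (n / 6).bodd (ofNat (n / 6).div2)
    | _ => count (n / 6).div2.div2.unpair.1.unpair.1 (n / 6).bodd
        (n / 6).div2.div2.unpair.1.unpair.2 (n / 6).div2.bodd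
        (ofNat (n / 6).div2.div2.unpair.2)

theorem ofNat_toNat (φ : GC2Formula) : ofNat (toNat φ) = φ := by
  have hd : ∀ m k : ℕ, k < 6 → (6 * m + k) / 6 = m := by intros; omega
  have hm : ∀ m k : ℕ, k < 6 → (6 * m + k) % 6 = k := by intros; omega
  have hd0 : ∀ m : ℕ, 6 * m / 6 = m := by intros; omega
  have hm0 : ∀ m : ℕ, 6 * m % 6 = 0 := by intros; omega
  induction φ with
  | eq u w => cases u <;> cases w <;> simp [toNat, ofNat]
  | _ =>
    simp [toNat, ofNat, hd, hm, hd0, hm0, Nat.bodd_bit, Nat.div2_bit, *]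

theorem toNat_ofNat (n : ℕ) : toNat (ofNat n) = n := by
  induction n using Nat.strong_induction_on with
  | _ n ih =>
    match n with
    | 0 => simp [toNat, ofNat]
    | 1 => simp [toNat, ofNat]
    | 2 => simp [toNat, ofNat]
    | 3 => simp [toNat, ofNat]
    | n + 4 =>
      have h0 : n / 6 < n + 4 := by omega
      have h1 : (n / 6).unpair.1 < n + 4 := lt_of_le_of_lt (Nat.unpair_left_le _) h0
      have h2 : (n / 6).unpair.2 < n + 4 := lt_of_le_of_lt (Nat.unpair_right_le _) h0
      have h3 : (n / 6).div2 < n + 4 := by rw [Nat.div2_val]; omega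
      have h4 : (n / 6).div2.div2.unpair.2 < n + 4 :=
        lt_of_le_of_lt (Nat.unpair_right_le _) (by rw [Nat.div2_val, Nat.div2_val]; omega)
      have hlt : n % 6 < 6 := Nat.mod_lt _ (by norm_num)
      have hdm := Nat.div_add_mod n 6
      simp only [ofNat]
      generalize hk : n % 6 = k at *
      interval_cases k <;>
        simp only [toNat, ih _ h0, ih _ h1, ih _ h2, ih _ h3, ih _ h4, Nat.pair_unpair,
          Nat.bit_bodd_div2] <;> omega

/-- Formulas are effectively numbered; this makes computability over formulas meaningful. -/
instance : Denumerable GC2Formula :=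
  Denumerable.mk' ⟨toNat, ofNat, ofNat_toNat, toNat_ofNat⟩

end GC2Formula

/-! ### Query answering -/

/-- `F ∧ Δ ∧ T ⊨ q`: every (finite or infinite) interpretation with non-empty domain that satisfies
the existential closure of the fact `F`, the existential rules `Δ` and the ontology `T`, also
satisfies the Boolean conjunctive query `q`.  Here `S` is the set of constraints of the ontology
language, and `sat` is their semantics. -/
def QAEntails {S : Type} (sat : {D : Type} → Interp D → S → Prop)
    (F : List Atom) (Δ : List ExRule) (T : List S) (q : List Atom) : Prop :=
  ∀ (D : Type) [Nonempty D] (I : Interp D),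
    I.satEx F → (∀ ρ ∈ Δ, ρ.Sat I) → (∀ s ∈ T, sat I s) → I.satEx q

/-- Query answering is decidable for the conjunction of source-to-target rules with an ontology
language, whose constraints are the elements of `S` that satisfy `wf`: one algorithm decides
`F ∧ Δ ∧ T ⊨ q`, given a fact `F`, a finite set `Δ` of source-to-target existential rules, a finite
set `T` of constraints of the ontology language, and a Boolean conjunctive query `q`. -/
def QADecidableWithS2T {S : Type} [Primcodable S] (wf : S → Prop)
    (sat : {D : Type} → Interp D → S → Prop) : Prop :=
  ∃ f : List Atom × List ExRule × List S × List Atom → Bool, Computable f ∧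
    ∀ (F : List Atom) (Δ : List ExRule) (T : List S) (q : List Atom),
      IsAtomConj F → IsSourceToTarget Δ → (∀ s ∈ T, wf s) → IsAtomConj q →
        (f (F, Δ, T, q) = true ↔ QAEntails sat F Δ T q)

/-!
Query answering is reduced from the halting problem. A partial recursive function with undecidable
domain is computed by some code `c : Turing.ToPartrec.Code`, whose semantics `c.eval` is a partial
function on lists of natural numbers. Each such partial function is represented by a binary
relation, and the evaluation of `c` is axiomatized by Horn clauses over these relations: one group
of clauses for each subcode (`evalRules`), and clauses for forming pairs and for `a.headI :: b`
(`consRules`). Lists are elements reached from an element standing for `[]` by the relations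
`v ↦ 0 :: v` and `n :: v ↦ (n + 1) :: v`. The query says that `c` has a value at `[n]`.

A Horn clause may have the same relation in its body and in its head, which source-to-target rules
do not allow. Hence each relation `r` has a source copy `r` and a target copy `r'`. If the
constraints make `r'` functional and give an `r`-successor to each element with an `r'`-successor,
then the source-to-target rule `r(x, y) → r'(x, y)` forces `r' ⊆ r` (`transfers_of_sat`): whenever
`r'(x, y)` holds, some `r(x, z)` holds, so `r'(x, z)` holds, and `y = z`. All relations to be
derived are partial functions, so functionality does no harm.

If the computation of `c` on `[n]` halts, then it is derived in every model, by induction on codes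
(`eval_src`), and the query is entailed. Conversely the lists themselves, with all relations given
their intended meaning, form a model (`rules_sat`, `constraints_sat`), in which the query holds only
if the computation halts (`dom_of_satEx_query`).

Only the query depends on `n`. Therefore the same reduction applies to any constraint language in
which `ALCF` assertions can be expressed at all (`not_qaDecidable`), such as `GC²`
(`exists_gc2Sentence`).
-/

open Turing.ToPartrec (Code)

namespace HornSimulation

/-! ### Roles, rules and constraints describing a code -/

/-- Binary predicates over lists of natural numbers: prefixing a zero, incrementing the head of a
nonempty list, the two projections of pairs, the function sending a pair `(a, b)` to
`a.headI :: b`, and the graph of each code. -/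
inductive Role where
  | zero : Role
  | incr : Role
  | fst : Role
  | snd : Role
  | cons : Role
  | eval : Code → Role

/-- An injective numbering of codes. -/
def codeIndex : Code → ℕ
  | Code.zero' => 0
  | Code.succ => 1
  | Code.tail => 2
  | Code.cons f g => 4 * Nat.pair (codeIndex f) (codeIndex g) + 3
  | Code.comp f g => 4 * Nat.pair (codeIndex f) (codeIndex g) + 4
  | Code.case f g => 4 * Nat.pair (codeIndex f) (codeIndex g) + 5
  | Code.fix f => 4 * codeIndex f + 6

theorem codeIndex_injective : Function.Injective codeIndex := by
  intro c
  induction c with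
  | zero' => intro d h; cases d <;> simp only [codeIndex] at h <;> first | rfl | omega
  | succ => intro d h; cases d <;> simp only [codeIndex] at h <;> first | rfl | omega
  | tail => intro d h; cases d <;> simp only [codeIndex] at h <;> first | rfl | omega
  | fix f ih =>
    intro d h
    cases d <;> simp only [codeIndex] at h <;> first | omega | skip
    exact congrArg Code.fix (ih (by omega))
  | cons f g ihf ihg | comp f g ihf ihg | case f g ihf ihg =>
    intro d h
    cases d <;> simp only [codeIndex] at h <;> first | omega | skip
    obtain ⟨hf, hg⟩ := Nat.pair_eq_pair.1
      (Nat.eq_of_mul_eq_mul_left (by norm_num) (Nat.add_right_cancel h))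
    rw [ihf hf, ihg hg]

namespace Role

/-- An injective numbering of roles. -/
def index : Role → ℕ
  | zero => 0
  | incr => 1
  | fst => 2
  | snd => 3
  | cons => 4
  | eval c => codeIndex c + 5

theorem index_injective : Function.Injective index := by
  intro r s h
  cases r <;> cases s <;> simp only [index] at h <;> first | rfl | omega | skip
  exact congrArg eval (codeIndex_injective (by omega))

/-- The atom `r(x, y)` over the source copy of the role `r`, which has an even name. -/
def src (r : Role) (x y : ℕ) : Atom := (2 * r.index, [x, y])

/-- The atom `r'(x, y)` over the target copy of the role `r`, which has an odd name. -/
def tgt (r : Role) (x y : ℕ) : Atom := (2 * r.index + 1, [x, y])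

/-- The source copy of the role `r` in an interpretation. -/
def Src {D : Type} (I : Interp D) (r : Role) (d e : D) : Prop := I.binary (2 * r.index) d e

/-- The target copy of the role `r` in an interpretation. -/
def Tgt {D : Type} (I : Interp D) (r : Role) (d e : D) : Prop := I.binary (2 * r.index + 1) d e

/-- The target copy of the role is contained in its source copy. -/
def Transfers {D : Type} (I : Interp D) (r : Role) : Prop := ∀ d e, r.Tgt I d e → r.Src I d e

end Role

open Role

/-- The atom stating that `x` is the empty list. -/
def nilAt (x : ℕ) : Atom := (0, [x])

/-- The atom over a concept name that is to hold everywhere: it lets a rule body bind `x` without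
constraining it. -/
def anyAt (x : ℕ) : Atom := (2, [x])

/-- The rules defining the graph of the code `c` from the graphs of its immediate subcodes. A list
is reached from `[]` by the roles `zero` and `incr`, so matching on these two roles is case
distinction on the head of a list. -/
def evalRules : Code → List ExRule
  | Code.zero' => [([zero.src 0 1], [(eval Code.zero').tgt 0 1])]
  | Code.succ =>
    [([nilAt 0, zero.src 0 1, incr.src 1 2], [(eval Code.succ).tgt 0 2]),
     ([nilAt 0, zero.src 0 1, incr.src 1 2, zero.src 3 4], [(eval Code.succ).tgt 4 2]),
     ([(eval Code.succ).src 0 1, incr.src 0 2, incr.src 1 3], [(eval Code.succ).tgt 2 3])]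
  | Code.tail =>
    [([nilAt 0], [(eval Code.tail).tgt 0 0]),
     ([zero.src 0 1], [(eval Code.tail).tgt 1 0]),
     ([(eval Code.tail).src 0 1, incr.src 0 2], [(eval Code.tail).tgt 2 1])]
  | Code.cons f g =>
    [([(eval f).src 0 1, (eval g).src 0 2, fst.src 3 1, snd.src 3 2, cons.src 3 4],
      [(eval (Code.cons f g)).tgt 0 4])]
  | Code.comp f g =>
    [([(eval g).src 0 1, (eval f).src 1 2], [(eval (Code.comp f g)).tgt 0 2])]
  | Code.case f g =>
    [([nilAt 0, (eval f).src 0 1], [(eval (Code.case f g)).tgt 0 1]),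
     ([zero.src 0 1, (eval f).src 0 2], [(eval (Code.case f g)).tgt 1 2]),
     ([incr.src 0 1, (eval g).src 0 2], [(eval (Code.case f g)).tgt 1 2])]
  | Code.fix f =>
    [([(eval f).src 0 1, nilAt 1], [(eval (Code.fix f)).tgt 0 1]),
     ([(eval f).src 0 1, zero.src 2 1], [(eval (Code.fix f)).tgt 0 2]),
     ([(eval f).src 0 1, incr.src 2 1, (eval Code.tail).src 1 3, (eval (Code.fix f)).src 3 4],
      [(eval (Code.fix f)).tgt 0 4])]

/-- The rule creating a pair of any two elements. -/
def pairRule : ExRule := ([anyAt 0, anyAt 1], [fst.tgt 2 0, snd.tgt 2 1])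

/-- The rules computing `a.headI :: b` from a pair `(a, b)`, by recursion on the head of `a`. -/
def consRules : List ExRule :=
  [([fst.src 0 1, nilAt 1, snd.src 0 2, zero.src 2 3], [cons.tgt 0 3]),
   ([fst.src 0 1, zero.src 4 1, snd.src 0 2, zero.src 2 3], [cons.tgt 0 3]),
   ([fst.src 0 1, incr.src 4 1, snd.src 0 2, fst.src 5 4, snd.src 5 2, cons.src 5 6, incr.src 6 3],
    [cons.tgt 0 3])]

/-- The rule copying the source version of a role into its target version. -/
def copyRule (r : Role) : ExRule := ([r.src 0 1], [r.tgt 0 1])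

/-- All subcodes of a code, including the code itself. -/
def subcodes : Code → List Code
  | Code.cons f g => Code.cons f g :: (subcodes f ++ subcodes g)
  | Code.comp f g => Code.comp f g :: (subcodes f ++ subcodes g)
  | Code.case f g => Code.case f g :: (subcodes f ++ subcodes g)
  | Code.fix f => Code.fix f :: subcodes f
  | c => [c]

/-- The codes whose graphs are axiomatized in order to evaluate `c`; the rules for `Code.fix` refer
to the graph of `Code.tail`. -/
def codes (c : Code) : List Code := Code.tail :: subcodes c

/-- The roles occurring in rule heads. -/
def derivedRoles (c : Code) : List Role := fst :: snd :: cons :: (codes c).map eval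

/-- The source-to-target rules axiomatizing the evaluation of `c`. -/
def rules (c : Code) : List ExRule :=
  (derivedRoles c).map copyRule ++ pairRule :: consRules ++ (codes c).flatMap evalRules

open ALCConcept in
/-- The constraints making the target copy of the role `r` functional and giving an `r`-successor to
each element with an `r'`-successor. Together with the copy rule for `r`, they force the two copies
to coincide. -/
def transferConstraints (r : Role) : List ALCFAssertion :=
  [Sum.inl (ex (2 * r.index + 1) top, ex (2 * r.index) top), Sum.inr (2 * r.index + 1)]

open ALCConcept in
/-- The `ALCF` constraints: the existence of the lists generated by `zero` and `incr` (the concept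
name `1` stands for the nonempty lists), the meaning of the concept name used by `anyAt`, and the
transfer constraints. -/
def constraints (c : Code) : List ALCFAssertion :=
  [Sum.inl (top, ex (2 * zero.index) (name 1)), Sum.inl (name 1, ex (2 * incr.index) (name 1)),
    Sum.inl (top, name 2)] ++ (derivedRoles c).flatMap transferConstraints

/-- The query stating that `c` has a value at `[n]`: the variables `0, …, n + 1` describe the lists
`[], [0], …, [n]`. -/
def query (c : Code) (n : ℕ) : List Atom :=
  [nilAt 0, zero.src 0 1] ++ (List.range n).map (fun k => incr.src (k + 1) (k + 2)) ++
    [(eval c).src (n + 1) (n + 2)]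

/-! ### Evaluation of atoms and rules -/

section Semantics

variable {D : Type} {I : Interp D}

theorem holdsAtom_pair (v : ℕ → D) (R x y : ℕ) :
    I.holdsAtom v (R, [x, y]) ↔ I.binary R (v x) (v y) := by
  have h : (fun i : Fin [x, y].length => v ([x, y].get i)) = ![v x, v y] := by
    funext i
    match i with
    | ⟨0, _⟩ => rfl
    | ⟨1, _⟩ => rfl
  exact iff_of_eq (congrArg (· ∈ I.rel R 2) h)

theorem holdsAtom_single (v : ℕ → D) (A x : ℕ) :
    I.holdsAtom v (A, [x]) ↔ I.unary A (v x) := by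
  have h : (fun i : Fin [x].length => v ([x].get i)) = ![v x] := by
    funext i
    match i with
    | ⟨0, _⟩ => rfl
  exact iff_of_eq (congrArg (· ∈ I.rel A 1) h)

@[simp] theorem holdsAtom_src (v : ℕ → D) (r : Role) (x y : ℕ) :
    I.holdsAtom v (r.src x y) ↔ r.Src I (v x) (v y) := holdsAtom_pair ..

@[simp] theorem holdsAtom_tgt (v : ℕ → D) (r : Role) (x y : ℕ) :
    I.holdsAtom v (r.tgt x y) ↔ r.Tgt I (v x) (v y) := holdsAtom_pair ..

@[simp] theorem holdsAtom_nilAt (v : ℕ → D) (x : ℕ) :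
    I.holdsAtom v (nilAt x) ↔ I.unary 0 (v x) := holdsAtom_single ..

@[simp] theorem holdsAtom_anyAt (v : ℕ → D) (x : ℕ) :
    I.holdsAtom v (anyAt x) ↔ I.unary 2 (v x) := holdsAtom_single ..

@[simp] theorem args_src (r : Role) (x y : ℕ) : (r.src x y).args = [x, y] := rfl

@[simp] theorem args_tgt (r : Role) (x y : ℕ) : (r.tgt x y).args = [x, y] := rfl

@[simp] theorem args_nilAt (x : ℕ) : (nilAt x).args = [x] := rfl

@[simp] theorem args_anyAt (x : ℕ) : (anyAt x).args = [x] := rfl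

@[simp] theorem holdsConj_nil (v : ℕ → D) : I.holdsConj v [] := by
  simp [Interp.holdsConj]

@[simp] theorem holdsConj_cons (v : ℕ → D) (a : Atom) (Φ : List Atom) :
    I.holdsConj v (a :: Φ) ↔ I.holdsAtom v a ∧ I.holdsConj v Φ := by
  simp [Interp.holdsConj]

/-- Where the target copy of a role transfers to the source copy, a rule without existential
variables acts as a Horn clause over source roles. -/
theorem src_of_sat {Φ : List Atom} {r : Role} {x y : ℕ}
    (h : ExRule.Sat I (Φ, [r.tgt x y])) (hr : r.Transfers I) (v : ℕ → D) (hv : I.holdsConj v Φ)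
    (hx : ∃ a ∈ Φ, x ∈ a.args) (hy : ∃ a ∈ Φ, y ∈ a.args) : r.Src I (v x) (v y) := by
  obtain ⟨w, hw, hh⟩ := h v hv
  obtain ⟨a, ha, hx⟩ := hx
  obtain ⟨b, hb, hy⟩ := hy
  rw [← hw a ha x hx, ← hw b hb y hy]
  exact hr _ _ (by simpa [ExRule.head] using hh)

/-- The copy rule bounds a role by its functional target copy, and each element with an
`r'`-successor has an `r`-successor, so every `r'`-edge is an `r`-edge. -/
theorem transfers_of_sat {r : Role} (hc : (copyRule r).Sat I)
    (ht : ∀ s ∈ transferConstraints r, s.Sat I) : r.Transfers I := by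
  intro d e hde
  simp only [transferConstraints, List.mem_cons, List.not_mem_nil, or_false, forall_eq_or_imp,
    forall_eq] at ht
  obtain ⟨hex, hfun⟩ := ht
  obtain ⟨e', he', -⟩ := hex (a := d) ⟨e, hde, trivial⟩
  obtain ⟨w, hw, hh⟩ := hc (fun i => [d, e'].getD i d) (by
    simpa [copyRule, ExRule.body, Role.Src] using he')
  have h0 := hw (r.src 0 1) (by simp [copyRule, ExRule.body]) 0 (by simp)
  have h1 := hw (r.src 0 1) (by simp [copyRule, ExRule.body]) 1 (by simp)
  have hh' : r.Tgt I (w 0) (w 1) := by simpa [copyRule, ExRule.head] using hh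
  rw [h0, h1] at hh'
  have : e = e' := hfun d e e' hde (by simpa [Role.Tgt] using hh')
  rw [this]
  exact he'

end Semantics

/-! ### The rules derive every computation -/

section Soundness

variable {D : Type} {I : Interp D}

/-- A map from lists to the domain of an interpretation that respects the generating roles. -/
structure IsListMap (I : Interp D) (x : List ℕ → D) : Prop where
  nil : I.unary 0 (x [])
  zero : ∀ v, zero.Src I (x v) (x (0 :: v))
  incr : ∀ n v, incr.Src I (x (n :: v)) (x ((n + 1) :: v))

/-- Every element has a `zero`-successor that starts an infinite `incr`-chain, so all lists can be
reached from an element standing for `[]`. -/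
theorem exists_isListMap {c : Code} (hT : ∀ s ∈ constraints c, s.Sat I) {o : D}
    (ho : I.unary 0 o) : ∃ x : List ℕ → D, IsListMap I x := by
  have hz : ∀ d, ∃ e, zero.Src I d e ∧ I.unary 1 e := fun d =>
    hT (Sum.inl (.top, .ex (2 * Role.zero.index) (.name 1))) (by simp [constraints])
      (a := d) trivial
  have hi : ∀ d, ∃ e, I.unary 1 d → incr.Src I d e ∧ I.unary 1 e := fun d => by
    by_cases hd : I.unary 1 d
    · obtain ⟨e, he⟩ := hT (Sum.inl (.name 1, .ex (2 * Role.incr.index) (.name 1)))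
        (by simp [constraints]) (a := d) hd
      exact ⟨e, fun _ => he⟩
    · exact ⟨d, fun h => absurd h hd⟩
  choose z hz using hz
  choose i hi using hi
  -- `n :: v` is obtained from `v` by one `zero`-step and `n` `incr`-steps.
  let x : List ℕ → D := fun v => v.foldr (fun n d => i^[n] (z d)) o
  have hne : ∀ n v, I.unary 1 (x (n :: v)) := by
    intro n v
    induction n with
    | zero => exact (hz _).2
    | succ n ih =>
      have := (hi _ ih).2
      simpa [x, Function.iterate_succ_apply'] using this
  refine ⟨x, ho, fun v => (hz _).1, fun n v => ?_⟩
  have := (hi _ (hne n v)).1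
  simpa [x, Function.iterate_succ_apply'] using this

/-- Any two lists have a pair on which the role `cons` takes the intended value. -/
theorem exists_cons {c : Code} (hΔ : ∀ ρ ∈ rules c, ρ.Sat I)
    (hT : ∀ s ∈ constraints c, s.Sat I) (htr : ∀ r ∈ derivedRoles c, r.Transfers I)
    {x : List ℕ → D} (hx : IsListMap I x) (a b : List ℕ) :
    ∃ p, fst.Src I p (x a) ∧ snd.Src I p (x b) ∧ cons.Src I p (x (a.headI :: b)) := by
  have hany : ∀ d, I.unary 2 d := fun d =>
    hT (Sum.inl (.top, .name 2)) (by simp [constraints]) (a := d) trivial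
  have hpair : ∀ d e, ∃ p, fst.Src I p d ∧ snd.Src I p e := by
    intro d e
    obtain ⟨w, hw, hh⟩ := hΔ pairRule (by simp [rules]) (fun i => [d, e].getD i d) (by
      simp [pairRule, ExRule.body, hany])
    have h0 := hw (anyAt 0) (by simp [pairRule, ExRule.body]) 0 (by simp)
    have h1 := hw (anyAt 1) (by simp [pairRule, ExRule.body]) 1 (by simp)
    simp only [pairRule, ExRule.head, holdsConj_cons, holdsAtom_tgt, h0, h1] at hh
    exact ⟨w 2, htr fst (by simp [derivedRoles]) _ _ hh.1,
      htr snd (by simp [derivedRoles]) _ _ hh.2.1⟩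
  have hcons : ∀ ρ ∈ consRules, ρ.Sat I := fun ρ hρ => hΔ ρ (by simp [rules, hρ])
  have htc : cons.Transfers I := htr cons (by simp [derivedRoles])
  simp only [consRules, List.mem_cons, List.not_mem_nil, or_false, forall_eq_or_imp,
    forall_eq] at hcons
  obtain ⟨h1, h2, h3⟩ := hcons
  cases a with
  | nil =>
    obtain ⟨p, hp1, hp2⟩ := hpair (x []) (x b)
    refine ⟨p, hp1, hp2, ?_⟩
    exact src_of_sat h1 htc (fun i => [p, x [], x b, x (0 :: b)].getD i p)
      (by simp [hp1, hp2, hx.nil, hx.zero]) (by simp) (by simp)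
  | cons n a =>
    induction n with
    | zero =>
      obtain ⟨p, hp1, hp2⟩ := hpair (x (0 :: a)) (x b)
      refine ⟨p, hp1, hp2, ?_⟩
      exact src_of_sat h2 htc (fun i => [p, x (0 :: a), x b, x (0 :: b), x a].getD i p)
        (by simp [hp1, hp2, hx.zero]) (by simp) (by simp)
    | succ n ih =>
      obtain ⟨q, hq1, hq2, hq3⟩ := ih
      obtain ⟨p, hp1, hp2⟩ := hpair (x ((n + 1) :: a)) (x b)
      refine ⟨p, hp1, hp2, ?_⟩
      exact src_of_sat h3 htc
        (fun i => [p, x ((n + 1) :: a), x b, x ((n + 1) :: b), x (n :: a), q, x (n :: b)].getD i p)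
        (by simpa [hp1, hp2, hq1, hq2, hx.incr] using hq3) (by simp) (by simp)

theorem tail_src (hρ : ∀ ρ ∈ evalRules Code.tail, ρ.Sat I) (htr : (eval Code.tail).Transfers I)
    {x : List ℕ → D} (hx : IsListMap I x) (v : List ℕ) :
    (eval Code.tail).Src I (x v) (x v.tail) := by
  simp only [evalRules, List.mem_cons, List.not_mem_nil, or_false, forall_eq_or_imp,
    forall_eq] at hρ
  obtain ⟨h1, h2, h3⟩ := hρ
  cases v with
  | nil =>
    exact src_of_sat h1 htr (fun _ => x []) (by simp [hx.nil]) (by simp) (by simp)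
  | cons n v =>
    induction n with
    | zero =>
      exact src_of_sat h2 htr (fun i => [x v, x (0 :: v)].getD i (x v)) (by simp [hx.zero])
        (by simp) (by simp)
    | succ n ih =>
      exact src_of_sat h3 htr (fun i => [x (n :: v), x v, x ((n + 1) :: v)].getD i (x v))
        (by simpa [hx.incr] using ih) (by simp) (by simp)

theorem succ_src (hρ : ∀ ρ ∈ evalRules Code.succ, ρ.Sat I) (htr : (eval Code.succ).Transfers I)
    {x : List ℕ → D} (hx : IsListMap I x) (v : List ℕ) :
    (eval Code.succ).Src I (x v) (x [v.headI + 1]) := by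
  simp only [evalRules, List.mem_cons, List.not_mem_nil, or_false, forall_eq_or_imp,
    forall_eq] at hρ
  obtain ⟨h1, h2, h3⟩ := hρ
  cases v with
  | nil =>
    exact src_of_sat h1 htr (fun i => [x [], x [0], x [1]].getD i (x []))
      (by simpa [hx.nil, hx.zero] using hx.incr 0 []) (by simp) (by simp)
  | cons n v =>
    induction n with
    | zero =>
      exact src_of_sat h2 htr (fun i => [x [], x [0], x [1], x v, x (0 :: v)].getD i (x []))
        (by simpa [hx.nil, hx.zero] using hx.incr 0 []) (by simp) (by simp)
    | succ n ih =>
      exact src_of_sat h3 htr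
        (fun i => [x (n :: v), x [n + 1], x ((n + 1) :: v), x [n + 1 + 1]].getD i (x v))
        (by simpa [hx.incr] using ih) (by simp) (by simp)

theorem mem_subcodes_self (c : Code) : c ∈ subcodes c := by
  cases c <;> simp [subcodes]

/-- In every model of the rules and constraints, the role of a code contains the image of the graph
of the code. -/
theorem eval_src {c : Code} (hΔ : ∀ ρ ∈ rules c, ρ.Sat I)
    (hT : ∀ s ∈ constraints c, s.Sat I) (htr : ∀ r ∈ derivedRoles c, r.Transfers I)
    {x : List ℕ → D} (hx : IsListMap I x) (d : Code) (hd : subcodes d ⊆ codes c) {v w : List ℕ}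
    (h : w ∈ d.eval v) : (eval d).Src I (x v) (x w) := by
  have hρ : ∀ d ∈ codes c, ∀ ρ ∈ evalRules d, ρ.Sat I := fun d hd ρ hρ =>
    hΔ ρ (by simp only [rules, List.mem_append, List.mem_flatMap]; exact Or.inr ⟨d, hd, hρ⟩)
  have hte : ∀ d ∈ codes c, (eval d).Transfers I := fun d hd =>
    htr _ (by simp [derivedRoles, hd])
  have htail : Code.tail ∈ codes c := by simp [codes]
  have hds := hd (mem_subcodes_self d)
  have hρd := hρ d hds
  have htd := hte d hds
  induction d generalizing v w with
  | zero' =>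
    simp only [Code.zero'_eval, Part.pure_eq_some, Part.mem_some_iff] at h
    subst h
    simp only [evalRules, List.mem_cons, List.not_mem_nil, or_false, forall_eq] at hρd
    exact src_of_sat hρd htd (fun i => [x v, x (0 :: v)].getD i (x v)) (by simp [hx.zero])
      (by simp) (by simp)
  | succ =>
    simp only [Code.succ_eval, Part.pure_eq_some, Part.mem_some_iff] at h
    subst h
    exact succ_src hρd htd hx v
  | tail =>
    simp only [Code.tail_eval, Part.pure_eq_some, Part.mem_some_iff] at h
    subst h
    exact tail_src hρd htd hx v
  | cons f g ihf ihg =>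
    simp only [subcodes, List.cons_subset, List.append_subset] at hd
    have hf := hd.2.1 (mem_subcodes_self f)
    have hg := hd.2.2 (mem_subcodes_self g)
    simp only [Code.cons_eval, Part.bind_eq_bind, Part.pure_eq_some, Part.mem_bind_iff,
      Part.mem_some_iff] at h
    obtain ⟨a, ha, b, hb, rfl⟩ := h
    have hfa := ihf hd.2.1 ha hf (hρ f hf) (hte f hf)
    have hgb := ihg hd.2.2 hb hg (hρ g hg) (hte g hg)
    obtain ⟨p, hp1, hp2, hp3⟩ := exists_cons hΔ hT htr hx a b
    simp only [evalRules, List.mem_cons, List.not_mem_nil, or_false, forall_eq] at hρd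
    exact src_of_sat hρd htd (fun i => [x v, x a, x b, p, x (a.headI :: b)].getD i p)
      (by simpa [hfa, hgb, hp1, hp2] using hp3) (by simp) (by simp)
  | comp f g ihf ihg =>
    simp only [subcodes, List.cons_subset, List.append_subset] at hd
    have hf := hd.2.1 (mem_subcodes_self f)
    have hg := hd.2.2 (mem_subcodes_self g)
    rw [Code.comp_eval] at h
    obtain ⟨a, ha, hb⟩ := Part.mem_bind_iff.1 h
    have hga := ihg hd.2.2 ha hg (hρ g hg) (hte g hg)
    have hfb := ihf hd.2.1 hb hf (hρ f hf) (hte f hf)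
    simp only [evalRules, List.mem_cons, List.not_mem_nil, or_false, forall_eq] at hρd
    exact src_of_sat hρd htd (fun i => [x v, x a, x w].getD i (x v))
      (by simpa [hga] using hfb) (by simp) (by simp)
  | case f g ihf ihg =>
    simp only [subcodes, List.cons_subset, List.append_subset] at hd
    have hf := hd.2.1 (mem_subcodes_self f)
    have hg := hd.2.2 (mem_subcodes_self g)
    simp only [evalRules, List.mem_cons, List.not_mem_nil, or_false, forall_eq_or_imp,
      forall_eq] at hρd
    obtain ⟨h1, h2, h3⟩ := hρd
    simp only [Code.case_eval] at h
    rcases v with _ | ⟨_ | n, v⟩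
    · have := ihf hd.2.1 h hf (hρ f hf) (hte f hf)
      exact src_of_sat h1 htd (fun i => [x [], x w].getD i (x [])) (by simpa [hx.nil] using this)
        (by simp) (by simp)
    · have := ihf hd.2.1 h hf (hρ f hf) (hte f hf)
      exact src_of_sat h2 htd (fun i => [x v, x (0 :: v), x w].getD i (x v))
        (by simpa [hx.zero] using this) (by simp) (by simp)
    · have := ihg hd.2.2 h hg (hρ g hg) (hte g hg)
      exact src_of_sat h3 htd (fun i => [x (n :: v), x ((n + 1) :: v), x w].getD i (x v))
        (by simpa [hx.incr] using this) (by simp) (by simp)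
  | fix f ihf =>
    simp only [subcodes, List.cons_subset] at hd
    have hf := hd.2 (mem_subcodes_self f)
    simp only [evalRules, List.mem_cons, List.not_mem_nil, or_false, forall_eq_or_imp,
      forall_eq] at hρd
    obtain ⟨h1, h2, h3⟩ := hρd
    rw [Code.fix_eval] at h
    refine PFun.fixInduction' (C := fun v => (eval f.fix).Src I (x v) (x w)) h ?_ ?_
    · intro v hv
      obtain ⟨a, ha, hw⟩ := (Part.mem_map_iff _).1 hv
      have hfa := ihf hd.2 ha hf (hρ f hf) (hte f hf)
      rcases a with _ | ⟨_ | n, a⟩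
      · obtain rfl : [] = w := by simpa using hw
        exact src_of_sat h1 htd (fun i => [x v, x []].getD i (x []))
          (by simpa [hx.nil] using hfa) (by simp) (by simp)
      · obtain rfl : a = w := by simpa using hw
        exact src_of_sat h2 htd (fun i => [x v, x (0 :: a), x a].getD i (x []))
          (by simpa [hx.zero] using hfa) (by simp) (by simp)
      · simp at hw
    · intro v u _ hv ih
      obtain ⟨a, ha, hw⟩ := (Part.mem_map_iff _).1 hv
      have hfa := ihf hd.2 ha hf (hρ f hf) (hte f hf)
      rcases a with _ | ⟨_ | n, a⟩
      · simp at hw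
      · simp at hw
      · obtain rfl : a = u := by simpa using hw
        have ht := tail_src (hρ _ htail) (hte _ htail) hx ((n + 1) :: a)
        exact src_of_sat h3 htd
          (fun i => [x v, x ((n + 1) :: a), x (n :: a), x a, x w].getD i (x []))
          (by simpa [hx.incr, hfa, ih] using ht) (by simp) (by simp)

/-- In every model containing the empty list, the query is satisfied if the computation halts. -/
theorem satEx_query {c : Code} {n : ℕ} (hF : I.satEx [nilAt 0]) (hΔ : ∀ ρ ∈ rules c, ρ.Sat I)
    (hT : ∀ s ∈ constraints c, s.Sat I) (h : (c.eval [n]).Dom) : I.satEx (query c n) := by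
  have htr : ∀ r ∈ derivedRoles c, r.Transfers I := fun r hr =>
    transfers_of_sat
      (hΔ _ (by simp only [rules, List.mem_append, List.mem_map]; exact .inl (.inl ⟨r, hr, rfl⟩)))
      (fun s hs => hT s (by
        simp only [constraints, List.mem_append, List.mem_flatMap]; exact .inr ⟨r, hr, hs⟩))
  obtain ⟨u, hu⟩ := hF
  obtain ⟨x, hx⟩ := exists_isListMap hT (o := u 0) (by simpa using hu)
  obtain ⟨w, hw⟩ := Part.dom_iff_mem.1 h
  have hev := eval_src hΔ hT htr hx c (by simp [codes]) hw
  -- Variable `k + 1` denotes the list `[k]` for `k ≤ n`, and variable `n + 2` the value of `c`.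
  refine ⟨fun k => if k = 0 then x [] else if k = n + 2 then x w else x [k - 1], ?_⟩
  intro a ha
  simp only [query, List.mem_append, List.mem_cons, List.not_mem_nil, or_false, List.mem_map,
    List.mem_range] at ha
  rcases ha with ((rfl | rfl) | ⟨k, hk, rfl⟩) | rfl
  · simpa using hx.nil
  · simpa using hx.zero []
  · have h1 : k ≠ n := by omega
    have h2 : k ≠ n + 1 := by omega
    simpa [h1, h2] using hx.incr k []
  · simpa using hev

end Soundness

/-! ### The model formed by the lists -/

section ListModel

/-- A pairing bijection, through which each list also serves as a pair of lists. -/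
def unpairList : List ℕ ≃ List ℕ × List ℕ := Denumerable.equiv₂ _ _

/-- The intended meaning of the roles. -/
def Role.Graph : Role → List ℕ → List ℕ → Prop
  | Role.zero, v, w => w = 0 :: v
  | Role.incr, v, w => ∃ n t, v = n :: t ∧ w = (n + 1) :: t
  | Role.fst, v, w => w = (unpairList v).1
  | Role.snd, v, w => w = (unpairList v).2
  | Role.cons, v, w => w = (unpairList v).1.headI :: (unpairList v).2
  | Role.eval c, v, w => w ∈ c.eval v

/-- The interpretation over the domain of lists in which both copies of each role (the names `2k`
and `2k + 1` for the role of index `k`) have their intended meaning. The concept names `0` and `1`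
stand for the empty and the nonempty lists, all others for the whole domain. -/
def listModel : Interp (List ℕ) where
  rel
    | 0, 1 => {t | t 0 = []}
    | 1, 1 => {t | t 0 ≠ []}
    | _, 1 => Set.univ
    | R, 2 => {t | ∃ r : Role, r.index = R / 2 ∧ r.Graph (t 0) (t 1)}
    | _, _ => ∅

theorem listModel_binary (R : ℕ) (v w : List ℕ) :
    listModel.binary R v w ↔ ∃ r : Role, r.index = R / 2 ∧ r.Graph v w := by
  rcases R with _ | _ | R <;> exact Iff.rfl

theorem exists_index_eq_and (r : Role) (v w : List ℕ) :
    (∃ s : Role, s.index = r.index ∧ s.Graph v w) ↔ r.Graph v w :=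
  ⟨fun ⟨_, hs, h⟩ => Role.index_injective hs ▸ h, fun h => ⟨r, rfl, h⟩⟩

@[simp] theorem src_listModel (r : Role) (v w : List ℕ) :
    r.Src listModel v w ↔ r.Graph v w := by
  rw [Role.Src, listModel_binary, Nat.mul_div_cancel_left _ (by norm_num), exists_index_eq_and]

@[simp] theorem tgt_listModel (r : Role) (v w : List ℕ) :
    r.Tgt listModel v w ↔ r.Graph v w := by
  rw [Role.Tgt, listModel_binary, show (2 * r.index + 1) / 2 = r.index by omega,
    exists_index_eq_and]

@[simp] theorem unary_zero_listModel (v : List ℕ) : listModel.unary 0 v ↔ v = [] := Iff.rfl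

@[simp] theorem unary_one_listModel (v : List ℕ) : listModel.unary 1 v ↔ v ≠ [] := Iff.rfl

@[simp] theorem unary_two_listModel (v : List ℕ) : listModel.unary 2 v := trivial

theorem sat_listModel {Φ : List Atom} {r : Role} {x y : ℕ}
    (h : ∀ v, listModel.holdsConj v Φ → r.Graph (v x) (v y)) :
    ExRule.Sat listModel (Φ, [r.tgt x y]) :=
  fun v hv => ⟨v, fun _ _ _ _ => rfl, by simpa [ExRule.head] using h v hv⟩

theorem graph_functional {r : Role} (hr : r ≠ Role.incr) {v w w' : List ℕ} (h : r.Graph v w)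
    (h' : r.Graph v w') : w = w' := by
  cases r with
  | incr => exact absurd rfl hr
  | eval c => exact Part.mem_unique h h'
  | _ => exact Eq.trans h (Eq.symm h')

theorem evalRules_sat (c : Code) : ∀ ρ ∈ evalRules c, ρ.Sat listModel := by
  cases c <;> simp only [evalRules, List.mem_cons, List.not_mem_nil, or_false, forall_eq_or_imp,
    forall_eq]
  case zero' =>
    refine sat_listModel fun v h => ?_
    simpa [Role.Graph] using h
  case succ =>
    refine ⟨sat_listModel fun v h => ?_, sat_listModel fun v h => ?_, sat_listModel fun v h => ?_⟩
    · simp only [holdsConj_cons, holdsAtom_nilAt, holdsAtom_src, src_listModel, Role.Graph,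
        unary_zero_listModel] at h
      obtain ⟨h0, h1, ⟨n, t, h2, h3⟩, -⟩ := h
      rw [h1, h0] at h2
      simp only [List.cons.injEq] at h2
      simp [Role.Graph, h0, h3, ← h2.1, ← h2.2]
    · simp only [holdsConj_cons, holdsAtom_nilAt, holdsAtom_src, src_listModel, Role.Graph,
        unary_zero_listModel] at h
      obtain ⟨h0, h1, ⟨n, t, h2, h3⟩, h4, -⟩ := h
      rw [h1, h0] at h2
      simp only [List.cons.injEq] at h2
      simp [Role.Graph, h4, h3, ← h2.1, ← h2.2]
    · simp only [holdsConj_cons, holdsAtom_src, src_listModel, Role.Graph] at h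
      obtain ⟨h0, ⟨n, t, h1, h2⟩, ⟨m, s, h3, h4⟩, -⟩ := h
      simp [h1, h3] at h0
      simp [Role.Graph, h2, h4, h0]
  case tail =>
    refine ⟨sat_listModel fun v h => ?_, sat_listModel fun v h => ?_, sat_listModel fun v h => ?_⟩
    · simp only [holdsConj_cons, holdsAtom_nilAt, unary_zero_listModel] at h
      simp [Role.Graph, h.1]
    · simp only [holdsConj_cons, holdsAtom_src, src_listModel, Role.Graph] at h
      simp [Role.Graph, h.1]
    · simp only [holdsConj_cons, holdsAtom_src, src_listModel, Role.Graph] at h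
      obtain ⟨h0, ⟨n, t, h1, h2⟩, -⟩ := h
      simp [h1] at h0
      simp [Role.Graph, h2, h0]
  case cons f g =>
    refine sat_listModel fun v h => ?_
    simp only [holdsConj_cons, holdsAtom_src, src_listModel, Role.Graph] at h
    obtain ⟨h0, h1, h2, h3, h4, -⟩ := h
    rw [← h2, ← h3] at h4
    simp only [Role.Graph, Code.cons_eval, Part.bind_eq_bind, Part.pure_eq_some, Part.mem_bind_iff,
      Part.mem_some_iff]
    exact ⟨_, h0, _, h1, h4⟩
  case comp f g =>
    refine sat_listModel fun v h => ?_
    simp only [holdsConj_cons, holdsAtom_src, src_listModel, Role.Graph] at h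
    simp only [Role.Graph, Code.comp_eval]
    exact Part.mem_bind_iff.2 ⟨_, h.1, h.2.1⟩
  case case f g =>
    refine ⟨sat_listModel fun v h => ?_, sat_listModel fun v h => ?_, sat_listModel fun v h => ?_⟩
    · simp only [holdsConj_cons, holdsAtom_nilAt, holdsAtom_src, src_listModel, Role.Graph,
        unary_zero_listModel] at h
      obtain ⟨h0, h1, -⟩ := h
      rw [h0] at h1
      simpa [Role.Graph, h0] using h1
    · simp only [holdsConj_cons, holdsAtom_src, src_listModel, Role.Graph] at h
      simpa [Role.Graph, h.1] using h.2.1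
    · simp only [holdsConj_cons, holdsAtom_src, src_listModel, Role.Graph] at h
      obtain ⟨⟨n, t, h0, h1⟩, h2, -⟩ := h
      rw [h0] at h2
      simpa [Role.Graph, h1] using h2
  case fix f =>
    refine ⟨sat_listModel fun v h => ?_, sat_listModel fun v h => ?_, sat_listModel fun v h => ?_⟩
    · simp only [holdsConj_cons, holdsAtom_nilAt, holdsAtom_src, src_listModel, Role.Graph,
        unary_zero_listModel] at h
      simp only [Role.Graph, Code.fix_eval]
      exact PFun.mem_fix_iff.2 (.inl ((Part.mem_map_iff _).2 ⟨_, h.1, by simp [h.2.1]⟩))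
    · simp only [holdsConj_cons, holdsAtom_src, src_listModel, Role.Graph] at h
      simp only [Role.Graph, Code.fix_eval]
      exact PFun.mem_fix_iff.2 (.inl ((Part.mem_map_iff _).2 ⟨_, h.1, by simp [h.2.1]⟩))
    · simp only [holdsConj_cons, holdsAtom_src, src_listModel, Role.Graph] at h
      obtain ⟨h0, ⟨n, t, h1, h2⟩, h3, h4, -⟩ := h
      simp only [Code.tail_eval, Part.pure_eq_some, Part.mem_some_iff, h2, List.tail_cons] at h3
      rw [Code.fix_eval] at h4
      simp only [Role.Graph, Code.fix_eval]
      exact PFun.mem_fix_iff.2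
        (.inr ⟨_, (Part.mem_map_iff _).2 ⟨_, h0, by simp [h2]⟩, h3 ▸ h4⟩)

theorem rules_sat (c : Code) : ∀ ρ ∈ rules c, ρ.Sat listModel := by
  intro ρ hρ
  simp only [rules, consRules, List.mem_append, List.mem_map, List.mem_cons, List.not_mem_nil,
    or_false, List.mem_flatMap] at hρ
  rcases hρ with (⟨r, -, rfl⟩ | rfl | rfl | rfl | rfl) | ⟨d, -, hd⟩
  · exact sat_listModel fun v h => by simpa using h
  · intro v _
    -- The existential variable `2` denotes the code of the pair.
    refine ⟨fun i => if i = 2 then unpairList.symm (v 0, v 1) else v i, ?_, ?_⟩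
    · simp [pairRule, ExRule.body]
    · simp [pairRule, ExRule.head, Role.Graph]
  · refine sat_listModel fun v h => ?_
    simp only [holdsConj_cons, holdsAtom_nilAt, holdsAtom_src, src_listModel, Role.Graph,
      unary_zero_listModel] at h
    obtain ⟨h0, h1, h2, h3, -⟩ := h
    simp [Role.Graph, h3, ← h0, h1, h2]
  · refine sat_listModel fun v h => ?_
    simp only [holdsConj_cons, holdsAtom_src, src_listModel, Role.Graph] at h
    obtain ⟨h0, h1, h2, h3, -⟩ := h
    simp [Role.Graph, h3, ← h0, h1, h2]
  · refine sat_listModel fun v h => ?_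
    simp only [holdsConj_cons, holdsAtom_src, src_listModel, Role.Graph] at h
    obtain ⟨h0, ⟨n, t, h1, h2⟩, h3, h4, h5, h6, ⟨m, s, h7, h8⟩, -⟩ := h
    rw [← h4, ← h5, h7, h1] at h6
    simp only [List.headI_cons, List.cons.injEq] at h6
    simp [Role.Graph, h8, ← h0, h2, ← h3, h6]
  · exact evalRules_sat d ρ hd

theorem constraints_sat (c : Code) : ∀ s ∈ constraints c, s.Sat listModel := by
  intro s hs
  simp only [constraints, transferConstraints, List.mem_append, List.mem_cons, List.not_mem_nil,
    or_false, List.mem_flatMap] at hs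
  rcases hs with (rfl | rfl | rfl) | ⟨r, hr, rfl | rfl⟩
  · exact fun v _ => ⟨0 :: v, (src_listModel Role.zero v _).2 rfl, by simp [ALCConcept.ext]⟩
  · rintro (_ | ⟨n, t⟩) hv
    · exact absurd rfl hv
    · exact ⟨(n + 1) :: t, (src_listModel Role.incr _ _).2 ⟨n, t, rfl, rfl⟩,
        by simp [ALCConcept.ext]⟩
  · exact fun v _ => unary_two_listModel v
  · rintro v ⟨w, hw, -⟩
    exact ⟨w, (src_listModel r v w).2 ((tgt_listModel r v w).1 hw), trivial⟩
  · intro v w w' h h'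
    have hne : r ≠ Role.incr := by
      rintro rfl
      simp [derivedRoles] at hr
    exact graph_functional hne ((tgt_listModel r v w).1 h) ((tgt_listModel r v w').1 h')

/-- In the list model, the first variables of the query can only denote `[], [0], …, [n]`. -/
theorem dom_of_satEx_query {c : Code} {n : ℕ} (h : listModel.satEx (query c n)) :
    (c.eval [n]).Dom := by
  obtain ⟨v, hv⟩ := h
  have h0 : v 0 = [] := by
    simpa using hv (nilAt 0) (by simp [query])
  have h1 : ∀ k ≤ n, v (k + 1) = [k] := by
    intro k hk
    induction k with
    | zero =>
      have := hv (Role.zero.src 0 1) (by simp [query])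
      simpa [Role.Graph, h0] using this
    | succ k ih =>
      have := hv (Role.incr.src (k + 1) (k + 2)) (by
        simp only [query, List.mem_append, List.mem_map, List.mem_range]
        exact .inl (.inr ⟨k, hk, rfl⟩))
      rw [holdsAtom_src, src_listModel, ih (by omega)] at this
      obtain ⟨m, t, h2, h3⟩ := this
      simp only [List.cons.injEq] at h2
      rw [h3, ← h2.1, ← h2.2]
  have h2 := hv ((eval c).src (n + 1) (n + 2)) (by simp [query])
  rw [holdsAtom_src, src_listModel, h1 n le_rfl] at h2
  exact Part.dom_iff_mem.2 ⟨_, h2⟩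

end ListModel

/-! ### Source-to-target form and computability of the reduction -/

/-- The source symbols: unary symbols, and binary symbols with an even name. -/
def sourceSymbols : Set (ℕ × ℕ) := {s | s.2 = 1 ∨ s.2 = 2 ∧ s.1 % 2 = 0}

/-- The target symbols: binary symbols with an odd name. -/
def targetSymbols : Set (ℕ × ℕ) := {s | s.2 = 2 ∧ s.1 % 2 = 1}

@[simp] theorem symbol_src_mem (r : Role) (x y : ℕ) : (r.src x y).symbol ∈ sourceSymbols :=
  .inr ⟨rfl, Nat.mul_mod_right 2 _⟩

@[simp] theorem symbol_nilAt_mem (x : ℕ) : (nilAt x).symbol ∈ sourceSymbols := .inl rfl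

@[simp] theorem symbol_anyAt_mem (x : ℕ) : (anyAt x).symbol ∈ sourceSymbols := .inl rfl

@[simp] theorem symbol_tgt_mem (r : Role) (x y : ℕ) : (r.tgt x y).symbol ∈ targetSymbols :=
  ⟨rfl, by simp [Role.tgt, Atom.symbol, Nat.add_mod]⟩

theorem isSourceToTarget_rules (c : Code) : IsSourceToTarget (rules c) := by
  refine ⟨sourceSymbols, targetSymbols, ?_, ?_⟩
  · rw [Set.disjoint_left]
    rintro ⟨R, n⟩ (h : n = 1 ∨ n = 2 ∧ R % 2 = 0) ⟨(h1 : n = 2), (h2 : R % 2 = 1)⟩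
    omega
  intro ρ hρ
  simp only [rules, consRules, List.mem_append, List.mem_map, List.mem_cons, List.not_mem_nil,
    or_false, List.mem_flatMap] at hρ
  rcases hρ with (⟨r, -, rfl⟩ | rfl | rfl | rfl | rfl) | ⟨d, -, hd⟩
  · simp [copyRule, IsAtomConj, ExRule.body, ExRule.head]
  · simp [pairRule, IsAtomConj, ExRule.body, ExRule.head]
  · simp [IsAtomConj, ExRule.body, ExRule.head]
  · simp [IsAtomConj, ExRule.body, ExRule.head]
  · simp [IsAtomConj, ExRule.body, ExRule.head]
  · revert ρ
    cases d <;> simp [evalRules, IsAtomConj, ExRule.body, ExRule.head, -Prod.forall]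

theorem isAtomConj_query (c : Code) (n : ℕ) : IsAtomConj (query c n) := by
  refine ⟨by simp [query], fun a ha => ?_⟩
  simp only [query, List.mem_append, List.mem_cons, List.not_mem_nil, or_false, List.mem_map,
    List.mem_range] at ha
  rcases ha with ((rfl | rfl) | ⟨k, -, rfl⟩) | rfl <;> simp

theorem primrec_src (r : Role) {f g : ℕ → ℕ} (hf : Primrec f) (hg : Primrec g) :
    Primrec fun n => r.src (f n) (g n) :=
  Primrec.pair (Primrec.const _)
    (Primrec.list_cons.comp hf (Primrec.list_cons.comp hg (Primrec.const [])))

theorem primrec_query (c : Code) : Primrec (query c) := by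
  have h1 : Primrec fun n : ℕ => n + 1 := Primrec.succ
  have h2 : Primrec fun n : ℕ => n + 2 := Primrec.succ.comp Primrec.succ
  refine Primrec.list_append.comp (Primrec.list_append.comp (Primrec.const _) ?_) ?_
  · exact Primrec.list_map Primrec.list_range
      ((primrec_src Role.incr h1 h2).comp Primrec.snd).to₂
  · exact Primrec.list_cons.comp (primrec_src _ h1 h2) (Primrec.const [])

/-- Some code has an undecidable halting problem on one-element lists. -/
theorem exists_code_undecidable :
    ∃ c : Code, ¬ ComputablePred fun n : ℕ => (c.eval [n]).Dom := by
  let g : ℕ →. ℕ := fun k => (Denumerable.ofNat Nat.Partrec.Code k).eval 0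
  have hg : Partrec g :=
    Nat.Partrec.Code.eval_part.comp (Computable.ofNat _) (Computable.const 0)
  obtain ⟨c, hc⟩ := Code.exists_code (Nat.Partrec'.part_iff₁.2 hg)
  refine ⟨c, fun h => ComputablePred.halting_problem 0 ?_⟩
  have hdom : ∀ n, (c.eval [n]).Dom ↔ (g n).Dom := by
    intro n
    rw [show c.eval [n] = _ from hc (n ::ᵥ List.Vector.nil)]
    exact Iff.rfl
  obtain ⟨f, hf, hp⟩ := ComputablePred.computable_iff.1 h
  refine ComputablePred.computable_iff.2
    ⟨fun d => f (Encodable.encode d), hf.comp Computable.encode, funext fun d => ?_⟩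
  have := congrFun hp (Encodable.encode d)
  rw [← this, hdom, show g (Encodable.encode d) = d.eval 0 by simp [g]]

/-- Query answering is undecidable for source-to-target rules combined with any constraint language
that expresses all `ALCF` assertions. No effective translation is needed, because only the query
varies in the reduction. -/
theorem not_qaDecidable {S : Type} [Primcodable S] {wf : S → Prop}
    {sat : {D : Type} → Interp D → S → Prop}
    (hS : ∀ s : ALCFAssertion, ∃ t : S, wf t ∧
      ∀ (D : Type) (I : Interp D) [Nonempty D], sat I t ↔ s.Sat I) :
    ¬ QADecidableWithS2T wf sat := by
  rintro ⟨f, hf, hdec⟩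
  choose tr hwf htr using hS
  obtain ⟨c, hc⟩ := exists_code_undecidable
  apply hc
  refine ComputablePred.computable_iff.2
    ⟨fun n => f ([nilAt 0], rules c, (constraints c).map tr, query c n), ?_, funext fun n => ?_⟩
  · exact hf.comp ((Computable.const _).pair ((Computable.const _).pair
      ((Computable.const _).pair (primrec_query c).to_comp)))
  have hT : ∀ {D : Type} [Nonempty D] (I : Interp D),
      (∀ t ∈ (constraints c).map tr, sat I t) ↔ ∀ s ∈ constraints c, s.Sat I := by
    intro D _ I
    simp only [List.forall_mem_map, htr]
  refine propext (Iff.trans ?_ (hdec [nilAt 0] (rules c) ((constraints c).map tr) (query c n)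
    (by simp [IsAtomConj]) (isSourceToTarget_rules c)
    (by simp only [List.forall_mem_map, hwf, implies_true])
    (isAtomConj_query c n)).symm)
  constructor
  · intro h D _ I hF hΔ hs
    exact satEx_query hF hΔ ((hT I).1 hs) h
  · intro h
    refine dom_of_satEx_query (h _ listModel ⟨fun _ => [], by simp⟩ (rules_sat c) ?_)
    exact (hT _).2 (constraints_sat c)

/-! ### Expressing `ALCF` in the guarded two-variable fragment with counting -/

open GC2Formula in
/-- The formula stating that the element denoted by `u` belongs to a concept. The two variables
alternate along nested role restrictions. -/
def conceptFormula : ALCConcept → Bool → GC2Formula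
  | ALCConcept.top, u => eq u u
  | ALCConcept.bot, u => neg (eq u u)
  | ALCConcept.name A, u => un A u
  | ALCConcept.neg C, u => neg (conceptFormula C u)
  | ALCConcept.inf C C', u => and (conceptFormula C u) (conceptFormula C' u)
  | ALCConcept.sup C C', u => neg (and (neg (conceptFormula C u)) (neg (conceptFormula C' u)))
  | ALCConcept.ex R C, u => count 1 (!u) R u (conceptFormula C !u)
  | ALCConcept.all R C, u => neg (count 1 (!u) R u (neg (conceptFormula C !u)))

theorem guarded_conceptFormula (C : ALCConcept) (u : Bool) : (conceptFormula C u).Guarded := by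
  induction C generalizing u with
  | neg C ih => exact ih u
  | inf C C' ih ih' | sup C C' ih ih' => exact ⟨ih u, ih' u⟩
  | ex R C ih | all R C ih => exact ih !u
  | _ => trivial

theorem free_conceptFormula (C : ALCConcept) (u z : Bool) (h : (conceptFormula C u).Free z) :
    z = u := by
  induction C generalizing u with
  | ex R C _ | all R C _ =>
    simpa [conceptFormula, GC2Formula.Free] using h
  | inf C C' ih ih' | sup C C' ih ih' =>
    simp only [conceptFormula, GC2Formula.Free] at h
    exact h.elim (ih u) (ih' u)
  | neg C ih => exact ih u h
  | _ => simpa [conceptFormula, GC2Formula.Free] using h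

theorem eval_conceptFormula {D : Type} (I : Interp D) (C : ALCConcept) (u : Bool) (v : Bool → D) :
    (conceptFormula C u).Eval I v ↔ v u ∈ C.ext I := by
  induction C generalizing u v with
  | ex R C ih =>
    simp only [conceptFormula, GC2Formula.Eval, ALCConcept.ext, ih, Nat.cast_one,
      Set.one_le_encard_iff_nonempty]
    simp [Set.Nonempty]
  | all R C ih =>
    simp only [conceptFormula, GC2Formula.Eval, ALCConcept.ext, ih, Nat.cast_one,
      Set.one_le_encard_iff_nonempty]
    simp [Set.Nonempty]
  | sup C C' ih ih' =>
    simp only [conceptFormula, GC2Formula.Eval, ALCConcept.ext, ih, ih', Set.mem_union]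
    tauto
  | inf C C' ih ih' => exact and_congr (ih u v) (ih' u v)
  | neg C ih => exact not_congr (ih u v)
  | _ => simp [conceptFormula, GC2Formula.Eval, ALCConcept.ext]

/-- Each `ALCF` assertion is equivalent to a `GC²` sentence: an inclusion says that no element
violates it, functionality of a role that no element has two successors. -/
theorem exists_gc2Sentence (s : ALCFAssertion) : ∃ φ : GC2Formula, φ.IsSentence ∧
    ∀ (D : Type) (I : Interp D) [Nonempty D], φ.Sat I ↔ s.Sat I := by
  rcases s with ⟨C, C'⟩ | R
  · refine ⟨.neg (.ex false (.and (conceptFormula C false) (.neg (conceptFormula C' false)))),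
      ⟨⟨⟨guarded_conceptFormula _ _, guarded_conceptFormula _ _⟩, false, fun z hz => ?_⟩,
        fun z hz => hz.1 ?_⟩, fun D I _ => ?_⟩
    · exact hz.elim (free_conceptFormula C _ _) (free_conceptFormula C' _ _)
    · exact hz.2.elim (free_conceptFormula C _ _) (free_conceptFormula C' _ _)
    · simp [GC2Formula.Sat, GC2Formula.Eval, eval_conceptFormula, ALCFAssertion.Sat,
        Set.subset_def]
  · refine ⟨.neg (.ex false (.count 2 true R false (.eq true true))),
      ⟨⟨trivial, false, fun z hz => ?_⟩, fun z hz => ?_⟩, fun D I _ => ?_⟩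
    · simpa [GC2Formula.Free] using hz
    · simp [GC2Formula.Free] at hz
    · have h2 : ((2 : ℕ) : ℕ∞) = 1 + 1 := by norm_num
      simp only [GC2Formula.Sat, GC2Formula.Eval, ALCFAssertion.Sat, h2,
        ENat.add_one_le_iff ENat.one_ne_top, Set.one_lt_encard_iff]
      simp
      exact ⟨fun h d e e' he he' => h d e he e' he', fun h d e he e' he' => h d e e' he he'⟩

end HornSimulation

theorem mainTheorem2 :
    ¬ QADecidableWithS2T (S := ALCFAssertion) (fun _ => True) (fun I s => s.Sat I) ∧
    ¬ QADecidableWithS2T (S := GC2Formula) GC2Formula.IsSentence (fun I φ => φ.Sat I) :=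
  ⟨HornSimulation.not_qaDecidable fun s => ⟨s, trivial, fun _ _ _ => Iff.rfl⟩,
    HornSimulation.not_qaDecidable HornSimulation.exists_gc2Sentence⟩
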